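/- Let $n,p,q,l$ be nonnegative integers. Let $C, M_1,\dots,M_l$ be real symmetric positive semidefinite $n\times n$ matrices, let $R_0,R_1,\dots,R_l$ be arbitrary real symmetric $p\times p$ matrices, let $h_0,h_1,\dots,h_l\in\mathbb{R}^q$ and $b=(b_1,\dots,b_l)^T\in\mathbb{R}^l$, and let $H$ be the $q\times l$ matrix with columns $h_1,\dots,h_l$. Write $\langle A,B\rangle=\operatorname{trace}(A^TB)$; let $A\succeq B$ (resp. $A\succ B$) mean that $A-B$ is symmetric positive semidefinite (resp. positive definite), and let $A\prec B$ mean $B\succ A$. Consider the problem $$(P)\qquad \sup_{X,Y,\lambda}\ \langle C,X\rangle+\langle R_0,Y\rangle+h_0^T\lambda\quad\text{s.t.}\quad \langle M_i,X\rangle\le b_i+\langle R_i,Y\rangle+h_i^T\lambda\ \ (i=1,\dots,l),$$ over symmetric $n\times n$ matrices $X\succeq 0$, symmetric $p\times p$ matrices $Y\succeq 0$ and vectors $\lambda\in\mathbb{R}^q$. A solution of $(P)$ is a feasible triple $(X,Y,\lambda)$ at which the supremum is attained. Assume that $(P)$ is feasible and that its Lagrangian dual satisfies the following refined Slater condition: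 there is $\overline{\mu}\in\mathbb{R}^l$ with $\overline{\mu}\ge 0$ such that $$\sum_{i=1}^l\overline{\mu}_iM_i\succ C,\qquad R_0+\sum_{i=1}^l\overline{\mu}_iR_i\prec 0,\qquad h_0+H\overline{\mu}=0.$$ Then $(P)$ has a solution $(X,Y,\lambda)$ with $\operatorname{rank}X\le\operatorname{rank}C$. Moreover, if $C\neq 0$ (which forces $l\ge 1$), then every solution $(X,Y,\lambda)$ of $(P)$ satisfies $$\operatorname{rank}X\le n-\overline{r}+\operatorname{rank}C,\qquad \overline{r}:=\min_{1\le i\le l}\operatorname{rank}M_i.$$ -/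

import Mathlib

/-- The data of a combined semidefinite packing problem
`sup ⟨C, X⟩ + ⟨R₀, Y⟩ + h₀ᵀ lam` subject to
`⟨M i, X⟩ ≤ b i + ⟨R i, Y⟩ + (h i)ᵀ lam` for all `i`, `X ⪰ 0`, `Y ⪰ 0`, `lam ∈ ℝ^q`. -/
structure CombinedSDP (n p q l : ℕ) where
  C : Matrix (Fin n) (Fin n) ℝ
  M : Fin l → Matrix (Fin n) (Fin n) ℝ
  R₀ : Matrix (Fin p) (Fin p) ℝ
  R : Fin l → Matrix (Fin p) (Fin p) ℝ
  h₀ : Fin q → ℝ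
  h : Fin l → Fin q → ℝ
  b : Fin l → ℝ

namespace CombinedSDP

/-- The inner product `⟨A, B⟩ = trace (Aᵀ B)` of real matrices. -/
def matInner {m : ℕ} (A B : Matrix (Fin m) (Fin m) ℝ) : ℝ :=
  (A.transpose * B).trace

/-- The assumptions on the data: `C` and every `M i` are positive semidefinite, `R₀` and every
`R i` are symmetric. -/
structure IsAdmissible {n p q l : ℕ} (P : CombinedSDP n p q l) : Prop where
  posSemidef_C : P.C.PosSemidef
  posSemidef_M : ∀ i, (P.M i).PosSemidef
  isSymm_R₀ : P.R₀.IsSymm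
  isSymm_R : ∀ i, (P.R i).IsSymm

/-- The objective function. -/
def objective {n p q l : ℕ} (P : CombinedSDP n p q l) (X : Matrix (Fin n) (Fin n) ℝ)
    (Y : Matrix (Fin p) (Fin p) ℝ) (lam : Fin q → ℝ) : ℝ :=
  matInner P.C X + matInner P.R₀ Y + dotProduct P.h₀ lam

/-- `(X, Y, lam)` satisfies all the constraints. -/
def IsFeasible {n p q l : ℕ} (P : CombinedSDP n p q l) (X : Matrix (Fin n) (Fin n) ℝ)
    (Y : Matrix (Fin p) (Fin p) ℝ) (lam : Fin q → ℝ) : Prop :=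
  X.PosSemidef ∧ Y.PosSemidef ∧
    ∀ i, matInner (P.M i) X ≤ P.b i + matInner (P.R i) Y + dotProduct (P.h i) lam

/-- `(X, Y, lam)` is a solution: it is feasible and attains the supremum. -/
def IsSolution {n p q l : ℕ} (P : CombinedSDP n p q l) (X : Matrix (Fin n) (Fin n) ℝ)
    (Y : Matrix (Fin p) (Fin p) ℝ) (lam : Fin q → ℝ) : Prop :=
  P.IsFeasible X Y lam ∧
    ∀ X' Y' lam', P.IsFeasible X' Y' lam' → P.objective X' Y' lam' ≤ P.objective X Y lam

/-- The `q × l` matrix `H` whose columns are the vectors `h i`. -/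
def H {n p q l : ℕ} (P : CombinedSDP n p q l) : Matrix (Fin q) (Fin l) ℝ :=
  Matrix.of fun j i => P.h i j

/-- The refined Slater condition for the Lagrangian dual
`inf bᵀ μ` subject to `μ ≥ 0`, `∑ i, μ i • M i ⪰ C`, `R₀ + ∑ i, μ i • R i ⪯ 0`, `h₀ + H μ = 0`:
some dual feasible `μ` satisfies the two matrix inequalities strictly. -/
def DualRefinedSlater {n p q l : ℕ} (P : CombinedSDP n p q l) : Prop :=
  ∃ μ : Fin l → ℝ, 0 ≤ μ ∧
    ((∑ i, μ i • P.M i) - P.C).PosDef ∧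
    (-(P.R₀ + ∑ i, μ i • P.R i)).PosDef ∧
    P.h₀ + P.H.mulVec μ = 0

end CombinedSDP

open scoped MatrixOrder
open Matrix

/-! Existence: weak duality at the Slater point `μ` bounds the objective by `b ⬝ᵥ μ` minus the
pairings of `X` and `Y` with two positive definite slacks. Those pairings are coercive on the
semidefinite cone, so superlevel sets are bounded in `(X, Y)`. Nothing bounds `lam`, so it is
projected out; the projection stays closed because `lam` enters only through finitely many linear
inequalities (`isClosed_hypograph`). Compactness then gives a maximizer.

Rank: write `X = Sᴴ * S` and let `Q` be the support projection of `S * C * Sᴴ`. Then `X' = Sᴴ * Q *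
S` satisfies `X' ⪯ X`, has the same pairing with `C`, and has rank at most `C.rank`; as `M i ⪰ 0`,
it is again a solution. If `C ≠ 0`, some constraint `i` is tight at `X'`, hence also at `X`, so `M i
* (X - X') = 0`. Thus `X - X'` has rank at most `n - (M i).rank`, and subadditivity of rank
finishes. -/

/-- Fourier–Motzkin elimination: the set of left-hand sides for which a finite system of linear
inequalities is solvable is closed. -/
theorem isClosed_setOf_exists_le_dotProduct (q : ℕ) :
    ∀ {ι : Type} [Finite ι] (A : ι → Fin q → ℝ),
      IsClosed {w : ι → ℝ | ∃ lam : Fin q → ℝ, ∀ i, w i ≤ A i ⬝ᵥ lam} := by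
  induction q with
  | zero =>
    intro ι _ A
    have : {w : ι → ℝ | ∃ lam : Fin 0 → ℝ, ∀ i, w i ≤ A i ⬝ᵥ lam} = Set.Iic 0 := by
      ext w
      simp [Pi.le_def]
    rw [this]
    exact isClosed_Iic
  | succ q ih =>
    intro ι _ A
    let a : ι → Fin q → ℝ := fun i => Fin.tail (A i)
    let c : ι → ℝ := fun i => A i 0
    -- The coordinate `lam 0` is eliminated: rows free of it are kept, and each pair of rows with
    -- opposite signs is combined with positive weights that cancel it.
    let J := {i // c i = 0} ⊕ {i // 0 < c i} × {j // c j < 0}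
    let B : J → Fin q → ℝ :=
      Sum.elim (fun i => a i) (fun ij => (-c ij.2) • a ij.1 + c ij.1 • a ij.2)
    let T : (ι → ℝ) → J → ℝ := fun w =>
      Sum.elim (fun i => w i) (fun ij => (-c ij.2) * w ij.1 + c ij.1 * w ij.2)
    have hT : Continuous T := by
      refine continuous_pi ?_
      rintro (i | ij)
      · exact continuous_apply i.1
      · exact ((continuous_apply ij.1.1).const_mul _).add ((continuous_apply ij.2.1).const_mul _)
    convert (ih B).preimage hT using 1
    ext w
    simp only [Set.mem_ofPred_eq, Set.mem_preimage]
    constructor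
    · rintro ⟨lam, h⟩
      have h' : ∀ i, w i ≤ c i * lam 0 + a i ⬝ᵥ Fin.tail lam := fun i => by
        simpa [dotProduct, Fin.sum_univ_succ, Fin.tail, a, c] using h i
      refine ⟨Fin.tail lam, ?_⟩
      rintro (i | ⟨⟨i, hi⟩, ⟨j, hj⟩⟩)
      · simpa [T, B, i.2] using h' i
      · have h1 := mul_le_mul_of_nonneg_left (h' i) (neg_pos.2 hj).le
        have h2 := mul_le_mul_of_nonneg_left (h' j) hi.le
        simp only [T, B, Sum.elim_inr, add_dotProduct, smul_dotProduct, smul_eq_mul]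
        linarith
    · rintro ⟨lam, h⟩
      let f : ι → ℝ := fun i => (w i - a i ⬝ᵥ lam) / c i
      have hf : ∀ i : {i // 0 < c i}, ∀ j : {j // c j < 0}, f i ≤ f j := by
        rintro ⟨i, hi⟩ ⟨j, hj⟩
        have := h (Sum.inr (⟨i, hi⟩, ⟨j, hj⟩))
        simp only [T, B, Sum.elim_inr, add_dotProduct, smul_dotProduct, smul_eq_mul] at this
        simp only [f]
        rw [div_le_iff₀ hi, div_mul_eq_mul_div, le_div_iff_of_neg hj]
        linarith
      -- `t` is the eliminated coordinate: row `i` bounds it by `f i`, from below if `c i > 0` and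
      -- from above if `c i < 0`.
      obtain ⟨t, ht1, ht2⟩ : ∃ t, (∀ i, 0 < c i → f i ≤ t) ∧ (∀ j, c j < 0 → t ≤ f j) := by
        have hbdd := (Set.finite_range (fun i : {i // 0 < c i} => f i)).bddAbove
        rcases isEmpty_or_nonempty {i // 0 < c i} with he | hne
        · obtain ⟨t, ht⟩ := (Set.finite_range f).bddBelow
          exact ⟨t, fun i hi => (he.false ⟨i, hi⟩).elim, fun j _ => ht ⟨j, rfl⟩⟩
        · exact ⟨⨆ i : {i // 0 < c i}, f i, fun i hi => le_ciSup hbdd ⟨i, hi⟩,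
            fun j hj => ciSup_le fun i => hf i ⟨j, hj⟩⟩
      refine ⟨Fin.cons t lam, fun i => ?_⟩
      have key : A i ⬝ᵥ (Fin.cons t lam : Fin (q + 1) → ℝ) = c i * t + a i ⬝ᵥ lam := by
        simp [dotProduct, Fin.sum_univ_succ, Fin.tail, a, c]
      rw [key]
      rcases lt_trichotomy (c i) 0 with hc | hc | hc
      · have := ht2 i hc
        rw [le_div_iff_of_neg hc] at this
        linarith
      · have := h (Sum.inl ⟨i, hc⟩)
        simp only [T, B, Sum.elim_inl] at this
        rw [hc]
        linarith
      · have := ht1 i hc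
        rw [div_le_iff₀ hc] at this
        linarith

/-! ### Positive semidefinite matrices: traces, ranks, coercivity. -/

namespace Matrix

variable {m : Type*} [Fintype m]

theorem rank_add_le_rank_add_rank {K : Type*} [Field K] (A B : Matrix m m K) :
    (A + B).rank ≤ A.rank + B.rank := by
  refine le_trans (Submodule.finrank_mono ?_)
    (Submodule.finrank_add_le_finrank_add_finrank A.mulVecLin.range B.mulVecLin.range)
  rintro _ ⟨v, rfl⟩
  rw [mulVecLin_add]
  exact Submodule.add_mem_sup ⟨v, rfl⟩ ⟨v, rfl⟩

theorem isClosed_setOf_posSemidef : IsClosed {A : Matrix m m ℝ | A.PosSemidef} := by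
  have : {A : Matrix m m ℝ | A.PosSemidef} =
      {A | Aᴴ = A} ∩ ⋂ x : m → ℝ, {A | 0 ≤ star x ⬝ᵥ (A *ᵥ x)} := by
    ext A
    simp [posSemidef_iff_dotProduct_mulVec, IsHermitian]
  rw [this]
  refine (isClosed_eq (by fun_prop) continuous_id).inter (isClosed_iInter fun x => ?_)
  exact isClosed_le continuous_const (by fun_prop)

variable [DecidableEq m]

theorem PosSemidef.exists_eq_conjTranspose_mul_self {A : Matrix m m ℝ} (hA : A.PosSemidef) :
    ∃ S : Matrix m m ℝ, A = Sᴴ * S :=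
  CStarAlgebra.nonneg_iff_eq_star_mul_self.mp hA.nonneg

theorem PosSemidef.trace_mul_nonneg {A B : Matrix m m ℝ} (hA : A.PosSemidef)
    (hB : B.PosSemidef) : 0 ≤ (A * B).trace := by
  obtain ⟨S, rfl⟩ := hA.exists_eq_conjTranspose_mul_self
  rw [Matrix.mul_assoc, trace_mul_comm]
  exact (hB.mul_mul_conjTranspose_same S).trace_nonneg

theorem PosSemidef.mul_eq_zero_of_trace_mul_eq_zero {A B : Matrix m m ℝ} (hA : A.PosSemidef)
    (hB : B.PosSemidef) (h : (A * B).trace = 0) : A * B = 0 := by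
  obtain ⟨S, rfl⟩ := hA.exists_eq_conjTranspose_mul_self
  obtain ⟨T, rfl⟩ := hB.exists_eq_conjTranspose_mul_self
  -- The trace of `Sᴴ * S * (Tᴴ * T)` is the squared Frobenius norm of `S * Tᴴ`.
  have h0 : S * Tᴴ = 0 := by
    rw [← trace_mul_conjTranspose_self_eq_zero_iff, ← h, conjTranspose_mul,
      conjTranspose_conjTranspose, Matrix.mul_assoc, Matrix.mul_assoc, trace_mul_comm Sᴴ]
    simp only [Matrix.mul_assoc]
  calc Sᴴ * S * (Tᴴ * T) = Sᴴ * (S * Tᴴ) * T := by simp only [Matrix.mul_assoc]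
    _ = 0 := by rw [h0]; simp

/-- The support projection of a Hermitian matrix. -/
theorem IsHermitian.exists_support_projection {K : Matrix m m ℝ} (hK : K.IsHermitian) :
    ∃ Q : Matrix m m ℝ, Q.PosSemidef ∧ (1 - Q).PosSemidef ∧ K * Q = K ∧ Q.rank ≤ K.rank := by
  let φ := Unitary.conjStarAlgAut ℝ (Matrix m m ℝ) hK.eigenvectorUnitary
  let d := hK.eigenvalues
  have hKφ : K = φ (diagonal d) := hK.spectral_theorem
  have hφ : ∀ A : Matrix m m ℝ, A.PosSemidef → (φ A).PosSemidef := fun A hA =>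
    hA.mul_mul_conjTranspose_same _
  -- Since `0⁻¹ = 0`, the product `d i * (d i)⁻¹` is the indicator of `d i ≠ 0`.
  refine ⟨φ (diagonal fun i => d i * (d i)⁻¹), hφ _ ?_, ?_, ?_, ?_⟩
  · refine PosSemidef.diagonal fun i => ?_
    by_cases h : d i = 0 <;> simp [h]
  · rw [← map_one φ, ← map_sub, ← diagonal_one, diagonal_sub]
    refine hφ _ (PosSemidef.diagonal fun i => ?_)
    by_cases h : d i = 0 <;> simp [h]
  · conv_lhs => rw [hKφ]
    conv_rhs => rw [hKφ]
    rw [← map_mul, diagonal_mul_diagonal]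
    simp [← mul_assoc]
  · rw [← diagonal_mul_diagonal, map_mul, ← hKφ]
    exact rank_mul_le_left _ _

/-- A positive semidefinite `X` can be decreased to a matrix of rank at most `C.rank` without
changing its inner product with `C`. -/
theorem PosSemidef.exists_rank_le_trace_mul_eq {C X : Matrix m m ℝ} (hC : C.PosSemidef)
    (hX : X.PosSemidef) :
    ∃ X' : Matrix m m ℝ, X'.PosSemidef ∧ (X - X').PosSemidef ∧
      (C * X').trace = (C * X).trace ∧ X'.rank ≤ C.rank := by
  obtain ⟨S, rfl⟩ := hX.exists_eq_conjTranspose_mul_self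
  obtain ⟨Q, hQ, hQ1, hKQ, hr⟩ :=
    (hC.mul_mul_conjTranspose_same S).isHermitian.exists_support_projection
  refine ⟨Sᴴ * Q * S, hQ.conjTranspose_mul_mul_same S, ?_, ?_, ?_⟩
  · have := hQ1.conjTranspose_mul_mul_same S
    rwa [Matrix.mul_sub, Matrix.sub_mul, Matrix.mul_one] at this
  · calc (C * (Sᴴ * Q * S)).trace = (S * C * Sᴴ * Q).trace := by
          rw [← Matrix.mul_assoc, trace_mul_comm]; simp only [Matrix.mul_assoc]
      _ = (S * (C * Sᴴ)).trace := by rw [hKQ, Matrix.mul_assoc]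
      _ = (C * (Sᴴ * S)).trace := by rw [trace_mul_comm, Matrix.mul_assoc]
  · calc (Sᴴ * Q * S).rank ≤ Q.rank := (rank_mul_le_left _ _).trans (rank_mul_le_right _ _)
      _ ≤ (S * C * Sᴴ).rank := hr
      _ ≤ C.rank := (rank_mul_le_left _ _).trans (rank_mul_le_right _ _)

open scoped Matrix.Norms.Elementwise in
/-- A positive definite matrix is coercive on the positive semidefinite cone. -/
theorem PosDef.exists_mul_norm_le_trace_mul {A : Matrix m m ℝ} (hA : A.PosDef) :
    ∃ ε > 0, ∀ X : Matrix m m ℝ, X.PosSemidef → ε * ‖X‖ ≤ (A * X).trace := by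
  have hpos : ∀ X : Matrix m m ℝ, X.PosSemidef → X ≠ 0 → 0 < (A * X).trace := by
    intro X hX hX0
    refine lt_of_le_of_ne (hA.posSemidef.trace_mul_nonneg hX) fun h => hX0 ?_
    have h0 := hA.posSemidef.mul_eq_zero_of_trace_mul_eq_zero hX h.symm
    exact hA.isUnit.mul_right_eq_zero.1 h0
  let s : Set (Matrix m m ℝ) := {X | X.PosSemidef} ∩ Metric.sphere 0 1
  have hs : IsCompact s := (isCompact_sphere _ _).inter_left isClosed_setOf_posSemidef
  have hmem : ∀ X : Matrix m m ℝ, X.PosSemidef → X ≠ 0 → ‖X‖⁻¹ • X ∈ s := fun X hX hX0 =>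
    ⟨hX.smul (inv_nonneg.2 (norm_nonneg X)), by
      simp [norm_smul, inv_mul_cancel₀ (norm_ne_zero_iff.2 hX0)]⟩
  -- `s` is empty when the matrices have size zero.
  rcases s.eq_empty_or_nonempty with he | hne
  · refine ⟨1, one_pos, fun X hX => ?_⟩
    by_cases hX0 : X = 0
    · simp [hX0]
    · exact absurd (hmem X hX hX0) (by simp [he])
  · obtain ⟨X₀, hX₀, hmin⟩ := hs.exists_isMinOn hne
      (f := fun X : Matrix m m ℝ => (A * X).trace) (by fun_prop)
    refine ⟨(A * X₀).trace, hpos X₀ hX₀.1 ?_, fun X hX => ?_⟩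
    · rintro rfl
      simpa using hX₀.2
    · by_cases hX0 : X = 0
      · simp [hX0]
      · have h := hmin (hmem X hX hX0)
        simp only [Set.mem_ofPred_eq, Matrix.mul_smul, trace_smul, smul_eq_mul] at h
        have hn := norm_pos_iff.2 hX0
        rwa [inv_mul_eq_div, le_div_iff₀ hn] at h

end Matrix

/-! ### Duality, existence and rank bounds for the packing problem. -/

namespace CombinedSDP

variable {n p q l : ℕ} {P : CombinedSDP n p q l}

theorem matInner_eq_trace_mul {m : ℕ} {A : Matrix (Fin m) (Fin m) ℝ} (hA : A.IsSymm)
    (B : Matrix (Fin m) (Fin m) ℝ) : matInner A B = (A * B).trace := by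
  rw [matInner, hA.eq]

theorem IsAdmissible.isSymm_C (hP : P.IsAdmissible) : P.C.IsSymm := by
  simpa [IsHermitian, IsSymm] using hP.posSemidef_C.isHermitian

theorem IsAdmissible.isSymm_M (hP : P.IsAdmissible) (i : Fin l) : (P.M i).IsSymm := by
  simpa [IsHermitian, IsSymm] using (hP.posSemidef_M i).isHermitian

/-- Weak duality, with the slack of the dual matrix inequalities. -/
theorem IsFeasible.objective_le_sub (hP : P.IsAdmissible) {X : Matrix (Fin n) (Fin n) ℝ}
    {Y : Matrix (Fin p) (Fin p) ℝ} {lam : Fin q → ℝ} (h : P.IsFeasible X Y lam) {μ : Fin l → ℝ}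
    (hμ : 0 ≤ μ) (hH : P.h₀ + P.H.mulVec μ = 0) :
    P.objective X Y lam ≤ P.b ⬝ᵥ μ - (((∑ i, μ i • P.M i) - P.C) * X).trace -
      (-(P.R₀ + ∑ i, μ i • P.R i) * Y).trace := by
  have hsum : ∑ i, μ i * (P.M i * X).trace ≤
      ∑ i, μ i * (P.b i + (P.R i * Y).trace + P.h i ⬝ᵥ lam) := by
    refine Finset.sum_le_sum fun i _ => mul_le_mul_of_nonneg_left ?_ (hμ i)
    rw [← matInner_eq_trace_mul (hP.isSymm_M i), ← matInner_eq_trace_mul (hP.isSymm_R i)]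
    exact h.2.2 i
  have hlam : P.h₀ ⬝ᵥ lam + ∑ i, μ i * (P.h i ⬝ᵥ lam) = 0 := by
    have h0 : (P.h₀ + P.H.mulVec μ) ⬝ᵥ lam = 0 := by rw [hH, zero_dotProduct]
    rw [add_dotProduct] at h0
    rw [← h0]
    congr 1
    simp only [dotProduct, mulVec, H, of_apply, Finset.mul_sum, Finset.sum_mul]
    rw [Finset.sum_comm]
    exact Finset.sum_congr rfl fun _ _ => Finset.sum_congr rfl fun _ _ => by ring
  have hb : P.b ⬝ᵥ μ = ∑ i, μ i * P.b i := by
    simp only [dotProduct, mul_comm]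
  rw [objective, matInner_eq_trace_mul hP.isSymm_C, matInner_eq_trace_mul hP.isSymm_R₀, hb]
  simp only [mul_add, Finset.sum_add_distrib] at hsum
  simp only [Matrix.sub_mul, Matrix.neg_mul, Matrix.add_mul, Matrix.sum_mul, trace_sub, trace_neg,
    trace_add, trace_sum, Matrix.smul_mul, trace_smul, smul_eq_mul]
  linarith

/-- The pairs `(X, Y)` and values `s` such that some `lam` makes `(X, Y, lam)` feasible with
objective value at least `s`. -/
def hypograph (P : CombinedSDP n p q l) :
    Set (Matrix (Fin n) (Fin n) ℝ × Matrix (Fin p) (Fin p) ℝ × ℝ) :=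
  {z | ∃ lam, P.IsFeasible z.1 z.2.1 lam ∧ z.2.2 ≤ P.objective z.1 z.2.1 lam}

theorem isClosed_hypograph (P : CombinedSDP n p q l) : IsClosed P.hypograph := by
  -- `none` indexes the objective inequality, `some i` the constraint `i`.
  let A : Option (Fin l) → Fin q → ℝ := fun o => o.elim P.h₀ P.h
  let w : Matrix (Fin n) (Fin n) ℝ × Matrix (Fin p) (Fin p) ℝ × ℝ → Option (Fin l) → ℝ :=
    fun z o => o.elim (z.2.2 - (matInner P.C z.1 + matInner P.R₀ z.2.1))
      fun i => matInner (P.M i) z.1 - (P.b i + matInner (P.R i) z.2.1)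
  have hw : Continuous w := by
    refine continuous_pi ?_
    rintro (_ | i) <;> simp only [w, matInner, Option.elim] <;> fun_prop
  have heq : P.hypograph = ({z | z.1.PosSemidef} ∩ {z | z.2.1.PosSemidef}) ∩
      w ⁻¹' {v | ∃ lam : Fin q → ℝ, ∀ o, v o ≤ A o ⬝ᵥ lam} := by
    ext ⟨X, Y, s⟩
    simp only [hypograph, IsFeasible, objective, Set.mem_inter_iff, Set.mem_preimage,
      Set.mem_ofPred_eq, Option.forall, w, A, Option.elim, sub_le_iff_le_add']
    constructor
    · rintro ⟨lam, ⟨hX, hY, h⟩, hs⟩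
      exact ⟨⟨hX, hY⟩, lam, hs, h⟩
    · rintro ⟨⟨hX, hY⟩, lam, hs, h⟩
      exact ⟨lam, ⟨hX, hY, h⟩, hs⟩
  rw [heq]
  exact ((isClosed_setOf_posSemidef.preimage continuous_fst).inter
    (isClosed_setOf_posSemidef.preimage (continuous_fst.comp continuous_snd))).inter
      ((isClosed_setOf_exists_le_dotProduct q A).preimage hw)

open scoped Matrix.Norms.Elementwise in
theorem exists_isSolution (hP : P.IsAdmissible) (hfeas : ∃ X Y lam, P.IsFeasible X Y lam)
    (hslater : P.DualRefinedSlater) : ∃ X Y lam, P.IsSolution X Y lam := by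
  obtain ⟨μ, hμ, hA, hB, hH⟩ := hslater
  obtain ⟨X₀, Y₀, lam₀, h₀⟩ := hfeas
  obtain ⟨ε, hε, hεX⟩ := hA.exists_mul_norm_le_trace_mul
  obtain ⟨δ, hδ, hδY⟩ := hB.exists_mul_norm_le_trace_mul
  set s₀ := P.objective X₀ Y₀ lam₀
  let t := P.hypograph ∩ {z | s₀ ≤ z.2.2}
  have hclosed : IsClosed t :=
    P.isClosed_hypograph.inter (isClosed_le continuous_const (by fun_prop))
  have hbdd : t ⊆ Metric.closedBall 0 ((P.b ⬝ᵥ μ - s₀) / ε) ×ˢ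
      Metric.closedBall 0 ((P.b ⬝ᵥ μ - s₀) / δ) ×ˢ Set.Icc s₀ (P.b ⬝ᵥ μ) := by
    rintro ⟨X, Y, s⟩ ⟨⟨lam, hf, hs⟩, hs₀⟩
    have h1 := hf.objective_le_sub hP hμ hH
    have h2 := hεX X hf.1
    have h3 := hδY Y hf.2.1
    have h4 := mul_nonneg hε.le (norm_nonneg X)
    have h5 := mul_nonneg hδ.le (norm_nonneg Y)
    simp only [Set.mem_ofPred_eq] at hs hs₀
    simp only [Set.mem_prod, mem_closedBall_zero_iff, Set.mem_Icc, le_div_iff₀ hε, le_div_iff₀ hδ]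
    refine ⟨?_, ?_, ?_, ?_⟩ <;> linarith
  have ht : IsCompact t := ((isCompact_closedBall _ _).prod
    ((isCompact_closedBall _ _).prod isCompact_Icc)).of_isClosed_subset hclosed hbdd
  obtain ⟨⟨X, Y, s⟩, ⟨⟨lam, hf, hs⟩, hs₀⟩, hmax⟩ := ht.exists_isMaxOn
    ⟨(X₀, Y₀, s₀), ⟨lam₀, h₀, le_rfl⟩, le_refl s₀⟩
    (f := fun z : Matrix (Fin n) (Fin n) ℝ × Matrix (Fin p) (Fin p) ℝ × ℝ => z.2.2) (by fun_prop)
  refine ⟨X, Y, lam, hf, fun X' Y' lam' hf' => le_trans ?_ hs⟩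
  rcases le_total s₀ (P.objective X' Y' lam') with h | h
  · exact hmax (a := (X', Y', P.objective X' Y' lam')) ⟨⟨lam', hf', le_rfl⟩, h⟩
  · exact h.trans hs₀

theorem matInner_le_matInner {m : ℕ} {A X X' : Matrix (Fin m) (Fin m) ℝ} (hA : A.PosSemidef)
    (h : (X - X').PosSemidef) : matInner A X' ≤ matInner A X := by
  have h' : A.IsSymm := by simpa [IsHermitian, IsSymm] using hA.isHermitian
  have := hA.trace_mul_nonneg h
  rw [Matrix.mul_sub, trace_sub] at this
  rw [matInner_eq_trace_mul h', matInner_eq_trace_mul h']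
  linarith

/-- `Y` and `lam` are kept, so `X` and `X'` face the same right-hand sides;
`exists_rank_add_rank_le` relies on this and on `X' ⪯ X`. -/
theorem IsSolution.exists_rank_le (hP : P.IsAdmissible) {X : Matrix (Fin n) (Fin n) ℝ}
    {Y : Matrix (Fin p) (Fin p) ℝ} {lam : Fin q → ℝ} (h : P.IsSolution X Y lam) :
    ∃ X', P.IsSolution X' Y lam ∧ (X - X').PosSemidef ∧ X'.rank ≤ P.C.rank := by
  obtain ⟨⟨hX, hY, hM⟩, hopt⟩ := h
  obtain ⟨X', hX', hXX', htr, hr⟩ := hP.posSemidef_C.exists_rank_le_trace_mul_eq hX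
  refine ⟨X', ⟨⟨hX', hY, fun i => ?_⟩, fun X₁ Y₁ lam₁ h₁ => ?_⟩, hXX', hr⟩
  · exact (matInner_le_matInner (hP.posSemidef_M i) hXX').trans (hM i)
  · have := hopt X₁ Y₁ lam₁ h₁
    rwa [objective.eq_def _ X, matInner_eq_trace_mul hP.isSymm_C, ← htr,
      ← matInner_eq_trace_mul hP.isSymm_C] at this

/-- At a solution not all packing constraints can be slack, as `X` could then be increased. -/
theorem IsSolution.exists_active (hP : P.IsAdmissible) (hC : P.C ≠ 0)
    {X : Matrix (Fin n) (Fin n) ℝ} {Y : Matrix (Fin p) (Fin p) ℝ} {lam : Fin q → ℝ}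
    (h : P.IsSolution X Y lam) :
    ∃ i, P.b i + matInner (P.R i) Y + P.h i ⬝ᵥ lam ≤ matInner (P.M i) X := by
  by_contra! hslack
  obtain ⟨⟨hX, hY, -⟩, hopt⟩ := h
  have htC : 0 < P.C.trace := lt_of_le_of_ne hP.posSemidef_C.trace_nonneg fun h0 =>
    hC (hP.posSemidef_C.trace_eq_zero_iff.1 h0.symm)
  have hadd : ∀ {A : Matrix (Fin n) (Fin n) ℝ}, A.IsSymm → ∀ ε : ℝ,
      matInner A (X + ε • 1) = matInner A X + ε * A.trace := fun {A} hA ε => by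
    rw [matInner_eq_trace_mul hA, matInner_eq_trace_mul hA]
    simp [Matrix.mul_add]
  have hev : ∀ᶠ ε in nhdsWithin (0 : ℝ) (Set.Ioi 0), ∀ i,
      matInner (P.M i) (X + ε • 1) < P.b i + matInner (P.R i) Y + P.h i ⬝ᵥ lam := by
    refine Filter.eventually_all.2 fun i => nhdsWithin_le_nhds ?_
    have hc : Continuous fun ε : ℝ => matInner (P.M i) X + ε * (P.M i).trace := by fun_prop
    simp only [hadd (hP.isSymm_M i)]
    exact hc.continuousAt.eventually_lt_const (by simpa using hslack i)
  obtain ⟨ε, hε, hε0⟩ := (hev.and self_mem_nhdsWithin).exists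
  have hε0 : 0 < ε := hε0
  have hle := hopt (X + ε • 1) Y lam
    ⟨hX.add (PosSemidef.one.smul hε0.le), hY, fun i => (hε i).le⟩
  simp only [objective, hadd hP.isSymm_C] at hle
  have := mul_pos hε0 htC
  linarith

theorem IsSolution.exists_rank_add_rank_le (hP : P.IsAdmissible) (hC : P.C ≠ 0)
    {X : Matrix (Fin n) (Fin n) ℝ} {Y : Matrix (Fin p) (Fin p) ℝ} {lam : Fin q → ℝ}
    (h : P.IsSolution X Y lam) : ∃ i, X.rank + (P.M i).rank ≤ n + P.C.rank := by
  obtain ⟨X', hsol, hXX', hr⟩ := h.exists_rank_le hP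
  obtain ⟨i, hi⟩ := hsol.exists_active hP hC
  refine ⟨i, ?_⟩
  -- Tightness at `X'` and feasibility of `X` squeeze the trace of `M i * (X - X')` to zero.
  have hzero : P.M i * (X - X') = 0 := by
    refine (hP.posSemidef_M i).mul_eq_zero_of_trace_mul_eq_zero hXX' (le_antisymm ?_
      ((hP.posSemidef_M i).trace_mul_nonneg hXX'))
    have h1 := (h.1.2.2 i).trans hi
    rw [matInner_eq_trace_mul (hP.isSymm_M i), matInner_eq_trace_mul (hP.isSymm_M i)] at h1
    rw [Matrix.mul_sub, trace_sub]
    linarith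
  have h1 := rank_add_rank_le_card_of_mul_eq_zero hzero
  have h2 := rank_add_le_rank_add_rank (X - X') X'
  rw [sub_add_cancel] at h2
  rw [Fintype.card_fin] at h1
  omega

end CombinedSDP

theorem theorem6 {n p q l : ℕ} (P : CombinedSDP n p q l) (hP : P.IsAdmissible)
    (hfeas : ∃ X Y lam, P.IsFeasible X Y lam) (hslater : P.DualRefinedSlater) :
    (∃ X Y lam, P.IsSolution X Y lam ∧ X.rank ≤ P.C.rank) ∧
    (P.C ≠ 0 → ∀ X Y lam, P.IsSolution X Y lam →
      (X.rank : ℤ) ≤ (n : ℤ) - ((⨅ i, (P.M i).rank : ℕ) : ℤ) + (P.C.rank : ℤ)) := by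
  refine ⟨?_, fun hC X Y lam h => ?_⟩
  · obtain ⟨X, Y, lam, h⟩ := CombinedSDP.exists_isSolution hP hfeas hslater
    obtain ⟨X', h', -, hr⟩ := h.exists_rank_le hP
    exact ⟨X', Y, lam, h', hr⟩
  · obtain ⟨i, hi⟩ := h.exists_rank_add_rank_le hP hC
    -- The index `i` shows `l ≥ 1`, so the infimum is a true minimum and not the default `0`.
    have hinf : ⨅ i, (P.M i).rank ≤ (P.M i).rank := ciInf_le (OrderBot.bddBelow _) i
    omega
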